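/- Let $\Sigma$ be a finite alphabet and let $\mathrm{RegE}(\Sigma)$ be the set of expressions $e,f ::= a\in\Sigma \mid 0 \mid e\sqcup f \mid \top \mid e\sqcap f \mid 1 \mid e\star f \mid e^\diamond$. Transitions and polarities. The relation $\to$ on expressions is generated by $e\sqcup f\to e$, $e\sqcup f\to f$, $e\sqcap f\to e$, $e\sqcap f\to f$, $a\to 1$ for $a\in\Sigma$, $e\star 1\to e$, $e^\diamond\to 1$, $e^\diamond\to e^\diamond\star e$, and: $e\to f$ implies $g\star e\to g\star f$. The polarity $\mathrm{pol}$ is given by $\mathrm{pol}(e\star f)=\mathrm{pol}(f)$, $\mathrm{pol}(e\sqcup f)=\mathrm{pol}(1)=\mathrm{pol}(0)=\mathrm{pol}(e^\diamond)=\exists$, $\mathrm{pol}(e\sqcap f)=\mathrm{pol}(\top)=\forall$, and $\mathrm{pol}(a)={?a}$ for $a\in\Sigma$. The game $\mathcal G_\bullet$. Positions are pairs $(X\dashv e)$ with $X$ a finite set of expressions and $e$ an expression. The position belongs to Spoiler if some $t\in X\setminus\{1\}$ has polarity $\exists$ or $\forall$, or if $e=1\in X$; otherwise it belongs to Spoiler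 if $\mathrm{pol}(e)=\forall$, and to Duplicator in all remaining cases. The moves are ($\uplus$ denotes disjoint union): - explore: $(X\uplus\{t\}\dashv e)\to(X\cup\{t'\}\dashv e)$ if $\mathrm{pol}(t)=\exists$ and $t\to t'$; - fork: $(X\uplus\{t\}\dashv e)\to(X\cup\{t'\mid t\to t'\}\dashv e)$ if $\mathrm{pol}(t)=\forall$; - alea: $(X\dashv e)\to(X\dashv e')$ if $\mathrm{pol}(e)=\forall$, no element of $X\setminus\{1\}$ has polarity $\exists$ or $\forall$, and $e\to e'$; - choose: $(X\dashv e)\to(X\dashv e')$ if the position belongs to Duplicator, $\mathrm{pol}(e)=\exists$ and $e\to e'$; - junk: $(X\dashv e)\to(X\dashv e')$ if the position belongs to Duplicator, $\mathrm{pol}(e)={?a}$ for some $a\in\Sigma$, and $e\to e'$; - fill: $(X\uplus\{t\}\dashv e)\to(X\cup\{t'\}\dashv e')$ if the position belongs to Duplicator, $\mathrm{pol}(e)=\mathrm{pol}(t)={?a}$ for some $a\in\Sigma$, $e\to e'$ and $t\to t'$. The winning positions are the positions of Spoiler in which no alea move can be played. This is a Büchi game: a finite play that cannot be extended is won by Duplicator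 if and only if its last position is winning, and an infinite play is won by Duplicator if and only if it visits winning positions infinitely often. $\mathcal G_\bullet(X\dashv e)$ is the game started at $(X\dashv e)$. The theory. Let $T$ be the theory of inequations between expressions with the following axioms and rules, for all expressions $a,a',b,b',c$ (an equation stands for two inequations): - $a\le b$ and $b\le c$ imply $a\le c$; $a\le a\sqcup b$; $b\le a\sqcup b$; $b\le a$ and $c\le a$ imply $b\sqcup c\le a$; $a\sqcap b\le a$; $a\sqcap b\le b$; $a\le b$ and $a\le c$ imply $a\le b\sqcap c$; $a\sqcap(b\sqcup c)\le(a\sqcap b)\sqcup(a\sqcap c)$; - $a\star 1=a=1\star a$; $a\star(b\star c)=(a\star b)\star c$; $a\le a'$ and $b\le b'$ imply $a\star b\le a'\star b'$; $a\star(b\sqcup c)\le(a\star b)\sqcup(a\star c)$; $(a\star b)\sqcap(a\star c)\le a\star(b\sqcap c)$; $(a\star b)\sqcap c\le(a\sqcap c)\star b$; - $1\le a^\diamond$; $a^\diamond\star a\le a^\diamond$; $a\sqcap(b\star c)\le b$ implies $a\sqcap(b\star c^\diamond)\le b$; - $1\le a$. That is, $T$ is the theory of right-skewed Kleene algebras with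 distributive meets without its axioms about $0$ and $\top$, extended with the axiom $1\le a$. Theorem. Let $e,f\in\mathrm{RegE}(\Sigma)$ contain neither $0$ nor $\top$. If Duplicator has a winning strategy in $\mathcal G_\bullet(\{e\}\dashv f)$, then $e\le f$ is derivable in $T$. -/

import Mathlib

/-- The set of expressions over an alphabet `α`:
`a ∈ α | 0 | e ⊔ f | ⊤ | e ⊓ f | 1 | e ⋆ f | e^◇`. -/
inductive RegE (α : Type*) where
  | letter (a : α)
  | zero
  | join (e f : RegE α)
  | top
  | meet (e f : RegE α)
  | one
  | comp (e f : RegE α)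
  | iter (e : RegE α)

namespace RegE

noncomputable instance decEq {α : Type*} : DecidableEq (RegE α) := Classical.decEq _

/-- The expression contains neither `0` nor `⊤`. -/
def NoZeroTop {α : Type*} : RegE α → Prop
  | letter _ => True
  | zero => False
  | join e f => NoZeroTop e ∧ NoZeroTop f
  | top => False
  | meet e f => NoZeroTop e ∧ NoZeroTop f
  | one => True
  | comp e f => NoZeroTop e ∧ NoZeroTop f
  | iter e => NoZeroTop e

/-- The transition relation `e → f` on expressions. -/
inductive Step {α : Type*} : RegE α → RegE α → Prop where
  | join_left (e f : RegE α) : Step (join e f) e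
  | join_right (e f : RegE α) : Step (join e f) f
  | meet_left (e f : RegE α) : Step (meet e f) e
  | meet_right (e f : RegE α) : Step (meet e f) f
  | letter (a : α) : Step (letter a) one
  | comp_one (e : RegE α) : Step (comp e one) e
  | iter_one (e : RegE α) : Step (iter e) one
  | iter_unfold (e : RegE α) : Step (iter e) (comp (iter e) e)
  | comp_right (g e f : RegE α) : Step e f → Step (comp g e) (comp g f)

end RegE

/-- The three polarities of expressions: `∃`, `∀`, and a call `?a` to the letter `a`. -/
inductive Polarity (α : Type*) where
  | ex
  | all
  | call (a : α)

/-- The polarity of an expression. -/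
def RegE.pol {α : Type*} : RegE α → Polarity α
  | .letter a => .call a
  | .zero => .ex
  | .join _ _ => .ex
  | .top => .all
  | .meet _ _ => .all
  | .one => .ex
  | .comp _ f => f.pol
  | .iter _ => .ex

/-- Duplicator owns the positions of polarity `∃`, Spoiler those of polarity `∀`. -/
inductive Player where
  | duplicator
  | spoiler

/-- A Büchi arena with positions in `V`: the moves between positions, the owner of each position,
and the set of winning positions for Duplicator. -/
structure BuchiArena (V : Type*) where
  Move : V → V → Prop
  owner : V → Player
  win : Set V

namespace BuchiArena

/-- `p` is a finite partial play that begins with `v`. -/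
def IsPartialPlay {V : Type*} (G : BuchiArena V) (v : V) (p : List V) : Prop :=
  p.head? = some v ∧ p.IsChain G.Move

/-- `s` is (the set of finite partial plays of) a Duplicator strategy in the game on `G` starting
at `v`. An infinite play belongs to the strategy if and only if all its finite prefixes are
in `s`. -/
structure IsDuplicatorStrategy {V : Type*} (G : BuchiArena V) (v : V) (s : Set (List V)) :
    Prop where
  isPartialPlay : ∀ p ∈ s, G.IsPartialPlay v p
  nonempty : s.Nonempty
  prefix_closed : ∀ p ∈ s, ∀ q : List V, q ≠ [] → q <+: p → q ∈ s
  spoiler_moves : ∀ (p : List V) (w : V), p ++ [w] ∈ s → G.owner w = .spoiler →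
    ∀ m, G.Move w m → p ++ [w, m] ∈ s
  duplicator_moves : ∀ (p : List V) (w : V), p ++ [w] ∈ s → G.owner w = .duplicator →
    ∃! m, G.Move w m ∧ p ++ [w, m] ∈ s

/-- A strategy is winning if every finite play in it that cannot be extended ends in a winning
position, and every infinite play in it visits winning positions infinitely often. -/
structure IsWinning {V : Type*} (G : BuchiArena V) (s : Set (List V)) : Prop where
  finite_plays : ∀ (p : List V) (w : V), p ++ [w] ∈ s → (∀ m, ¬ G.Move w m) → w ∈ G.win
  infinite_plays : ∀ p : ℕ → V, (∀ n, (List.range (n + 1)).map p ∈ s) →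
    {i | p i ∈ G.win}.Infinite

/-- Duplicator has a winning strategy in the game on `G` starting at `v`. -/
def DuplicatorWins {V : Type*} (G : BuchiArena V) (v : V) : Prop :=
  ∃ s, G.IsDuplicatorStrategy v s ∧ G.IsWinning s

end BuchiArena

/-- A position `Γ ∣ X ⊣ e` of the simulation game. -/
structure SimPos (α : Type*) where
  Γ : Set α
  X : Finset (RegE α)
  e : RegE α

namespace SimPos

open Classical in
/-- The owner of a position `Γ ∣ X ⊣ e`. It is Spoiler if some `t ∈ X`, `t ≠ 1`, is not of
polarity `?a`, and also if the simulation is completed, i.e. `e = 1 ∈ X` (no move is possible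
there unless the first clause applies too). Otherwise it is given by the polarity of `e`, where
Duplicator owns the positions with `e` of polarity `?a`. -/
noncomputable def owner {α : Type*} (p : SimPos α) : Player :=
  if (∃ t ∈ p.X, t ≠ .one ∧ ∀ a, t.pol ≠ .call a) ∨ (p.e = .one ∧ .one ∈ p.X) then .spoiler
  else match p.e.pol with
    | .ex => .duplicator
    | .all => .spoiler
    | .call _ => .duplicator

/-- The move `alea`. -/
inductive Alea {α : Type*} : SimPos α → SimPos α → Prop where
  | mk (Γ : Set α) (X : Finset (RegE α)) (e e' : RegE α)
      (hpol : e.pol = .all)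
      (hX : ∀ t ∈ X, t.pol = .all ∨ t.pol = .ex → t = .one)
      (he : e.Step e') : Alea ⟨Γ, X, e⟩ ⟨Γ, X, e'⟩

/-- The moves of the simulation game. A disjoint union `Y ⊎ {t}` is written `insert t Y` with
`t ∉ Y`. -/
inductive Move {α : Type*} : SimPos α → SimPos α → Prop where
  | explore (Γ : Set α) (X Y X' : Finset (RegE α)) (t t' e : RegE α)
      (ht : t ∉ Y) (hX : X = insert t Y) (hX' : X' = insert t' Y)
      (hpol : t.pol = .ex) (hstep : t.Step t') :
      Move ⟨Γ, X, e⟩ ⟨Γ, X', e⟩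
  | fork (Γ : Set α) (X Y X' : Finset (RegE α)) (t e : RegE α)
      (ht : t ∉ Y) (hX : X = insert t Y) (hX' : (X' : Set (RegE α)) = ↑Y ∪ {t' | t.Step t'})
      (hpol : t.pol = .all) :
      Move ⟨Γ, X, e⟩ ⟨Γ, X', e⟩
  | alea (p q : SimPos α) (h : Alea p q) : Move p q
  | choose (Γ : Set α) (X : Finset (RegE α)) (e e' : RegE α)
      (hpos : owner ⟨Γ, X, e⟩ = .duplicator) (hpol : e.pol = .ex) (he : e.Step e') :
      Move ⟨Γ, X, e⟩ ⟨Γ, X, e'⟩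
  | junk (Γ : Set α) (X : Finset (RegE α)) (e e' : RegE α) (a : α)
      (hpos : owner ⟨Γ, X, e⟩ = .duplicator) (hpol : e.pol = .call a) (ha : a ∈ Γ)
      (he : e.Step e') :
      Move ⟨Γ, X, e⟩ ⟨Γ, X, e'⟩
  | fill (Γ : Set α) (X Y X' : Finset (RegE α)) (t t' e e' : RegE α) (a : α)
      (ht : t ∉ Y) (hX : X = insert t Y) (hX' : X' = insert t' Y)
      (hpos : owner ⟨Γ, X, e⟩ = .duplicator) (hpol : e.pol = .call a) (hpolt : t.pol = .call a)
      (he : e.Step e') (hstep : t.Step t') :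
      Move ⟨Γ, X, e⟩ ⟨Γ ∪ {a}, X', e'⟩

end SimPos

/-- The simulation arena. The winning positions are those of Spoiler, minus those where an
`alea` move can be played. -/
noncomputable def simGame (α : Type*) : BuchiArena (SimPos α) where
  Move := SimPos.Move
  owner := SimPos.owner
  win := {p | p.owner = .spoiler ∧ ¬ ∃ q, SimPos.Alea p q}

/-- The pointed simulation arena: a position `X ⊣ e` is regarded as the position `Γ ∣ X ⊣ e` of the
simulation arena where `Γ` is the whole alphabet. -/
noncomputable def pointedSimGame (α : Type*) : BuchiArena (Finset (RegE α) × RegE α) where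
  Move p q := (simGame α).Move ⟨Set.univ, p.1, p.2⟩ ⟨Set.univ, q.1, q.2⟩
  owner p := (simGame α).owner ⟨Set.univ, p.1, p.2⟩
  win := {p | (⟨Set.univ, p.1, p.2⟩ : SimPos α) ∈ (simGame α).win}

/-- Derivability of `e ≤ f` from the axioms of right-skewed Kleene algebras with distributive meets
without the axioms about `0` and `⊤`, extended with the axiom `1 ≤ a`. Equational axioms are split
into two inequations. -/
inductive PointedDerivable {α : Type*} : RegE α → RegE α → Prop where
  | trans {a b c : RegE α} : PointedDerivable a b → PointedDerivable b c → PointedDerivable a c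
  | le_join_left (a b : RegE α) : PointedDerivable a (.join a b)
  | le_join_right (a b : RegE α) : PointedDerivable b (.join a b)
  | join_le {a b c : RegE α} : PointedDerivable b a → PointedDerivable c a →
      PointedDerivable (.join b c) a
  | meet_le_left (a b : RegE α) : PointedDerivable (.meet a b) a
  | meet_le_right (a b : RegE α) : PointedDerivable (.meet a b) b
  | le_meet {a b c : RegE α} : PointedDerivable a b → PointedDerivable a c →
      PointedDerivable a (.meet b c)
  | meet_join (a b c : RegE α) :
      PointedDerivable (.meet a (.join b c)) (.join (.meet a b) (.meet a c))
  | comp_one_le (a : RegE α) : PointedDerivable (.comp a .one) a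
  | le_comp_one (a : RegE α) : PointedDerivable a (.comp a .one)
  | one_comp_le (a : RegE α) : PointedDerivable (.comp .one a) a
  | le_one_comp (a : RegE α) : PointedDerivable a (.comp .one a)
  | comp_assoc_le (a b c : RegE α) :
      PointedDerivable (.comp a (.comp b c)) (.comp (.comp a b) c)
  | le_comp_assoc (a b c : RegE α) :
      PointedDerivable (.comp (.comp a b) c) (.comp a (.comp b c))
  | comp_mono {a a' b b' : RegE α} : PointedDerivable a a' → PointedDerivable b b' →
      PointedDerivable (.comp a b) (.comp a' b')
  | comp_join (a b c : RegE α) :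
      PointedDerivable (.comp a (.join b c)) (.join (.comp a b) (.comp a c))
  | meet_comp (a b c : RegE α) :
      PointedDerivable (.meet (.comp a b) (.comp a c)) (.comp a (.meet b c))
  | half_distrib (a b c : RegE α) :
      PointedDerivable (.meet (.comp a b) c) (.comp (.meet a c) b)
  | one_le_iter (a : RegE α) : PointedDerivable .one (.iter a)
  | iter_comp_le (a : RegE α) : PointedDerivable (.comp (.iter a) a) (.iter a)
  | iter_induction {a b c : RegE α} : PointedDerivable (.meet a (.comp b c)) b →
      PointedDerivable (.meet a (.comp b (.iter c))) b
  | one_le (a : RegE α) : PointedDerivable .one a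

/-! A winning strategy may involve cycles, while `T` only has an explicit induction rule for
iterations. The cycles are removed on the two sides by different means.

On the right, the Büchi condition leaves only finitely many moves between winning positions, so won
positions lie in a least fixpoint (`DuplicatorWins.forced`). When all resources are calls to
letters, induction on that fixpoint bounds the right-hand side (`Simulates.le_of_fill`). A position
with a resource to explore or fork is winning, so the fixpoint restarts there, and termination on
the left needs another argument.

On the left, everything stays in the finite `closure` of `e`, and two subsets of it grow: `X`, of
expressions assumed to bound the left-hand side from above, and `A`, of expressions `d` for which `I
⋆ d` is assumed to do so as well. Here `I` is `invariant`, the meet of all that is to be proved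
about `X`. Both inductions run downwards from the full closure. A resource outside `X` is settled by
a larger `X`. An iteration of `c ∉ A` is settled by the induction rule with invariant `I`, whose
premise is the case `A ∪ {c}`. If `c ∈ A`, one unfolding makes `c` the active part, which is smaller
than the iteration. The resources are thus threads with shrinking active parts, and
`annotated_le_of_simulates` concludes by induction on their weight. Half-distributivity keeps the
current assumptions available when a letter is consumed. -/

/-! ### Büchi games: winning strategies and attractors -/

namespace BuchiArena

variable {V : Type*} {G : BuchiArena V}

/-- The positions from which Duplicator can force the play to reach `Z`. -/
inductive Attractor (G : BuchiArena V) (Z : Set V) : V → Prop where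
  | base {v : V} (hv : v ∈ Z) : Attractor G Z v
  | spoiler {v : V} (hv : G.owner v = .spoiler) (h : ∀ m, G.Move v m → Attractor G Z m) :
      Attractor G Z v
  | duplicator {v m : V} (hv : G.owner v = .duplicator) (hm : G.Move v m)
      (h : Attractor G Z m) : Attractor G Z v

/-- Duplicator can force the play to reach a winning position from which every move leads to a
position won by Duplicator. -/
def Forced (G : BuchiArena V) : V → Prop :=
  Attractor G {v | v ∈ G.win ∧ ∀ m, G.Move v m → G.DuplicatorWins m}

theorem IsDuplicatorStrategy.singleton_mem {v : V} {s : Set (List V)}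
    (hs : G.IsDuplicatorStrategy v s) : [v] ∈ s := by
  obtain ⟨p, hp⟩ := hs.nonempty
  refine hs.prefix_closed p hp [v] (by simp) ?_
  have h := (hs.isPartialPlay p hp).1
  cases p with
  | nil => simp at h
  | cons x p =>
    simp only [List.head?_cons, Option.some.injEq] at h
    subst h
    exact ⟨p, rfl⟩

/-- The residual of `s` after `p` is a strategy, and removing a finite prefix does not affect how
often winning positions are visited. -/
theorem DuplicatorWins.of_mem {v w : V} {s : Set (List V)} (hs : G.IsDuplicatorStrategy v s)
    (hw : G.IsWinning s) {p : List V} (hp : p ++ [w] ∈ s) : G.DuplicatorWins w := by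
  refine ⟨{q | q.head? = some w ∧ p ++ q ∈ s}, ⟨?_, ?_, ?_, ?_, ?_⟩, ⟨?_, ?_⟩⟩
  · rintro q ⟨hq, hpq⟩
    exact ⟨hq, (List.isChain_append.1 (hs.isPartialPlay _ hpq).2).2.1⟩
  · exact ⟨[w], rfl, hp⟩
  · rintro q ⟨hq, hpq⟩ r hr hrq
    refine ⟨?_, hs.prefix_closed _ hpq _ (by simp [hr]) ((List.prefix_append_right_inj p).2 hrq)⟩
    obtain ⟨u, rfl⟩ := hrq
    cases r with
    | nil => exact absurd rfl hr
    | cons x r => simpa using hq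
  · rintro q x ⟨hq, hpq⟩ hx m hm
    refine ⟨by cases q <;> simpa using hq, ?_⟩
    rw [← List.append_assoc] at hpq ⊢
    exact hs.spoiler_moves _ _ hpq hx m hm
  · rintro q x ⟨hq, hpq⟩ hx
    rw [← List.append_assoc] at hpq
    obtain ⟨m, ⟨hm, hms⟩, huniq⟩ := hs.duplicator_moves _ _ hpq hx
    refine ⟨m, ⟨hm, by cases q <;> simpa using hq, by rwa [← List.append_assoc]⟩, ?_⟩
    rintro m' ⟨hm', -, hms'⟩
    exact huniq m' ⟨hm', by rwa [List.append_assoc]⟩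
  · rintro q x ⟨-, hpq⟩ hx
    rw [← List.append_assoc] at hpq
    exact hw.finite_plays _ _ hpq hx
  · intro π hπ
    -- `ρ` is `p` followed by `π`: the default value takes over past the end of `p`.
    let ρ : ℕ → V := fun i => (p[i]?).getD (π (i - p.length))
    have hρ : ∀ i, ρ (p.length + i) = π i := fun i => by simp [ρ]
    have hlist : ∀ n, (List.range (p.length + n)).map ρ = p ++ (List.range n).map π := by
      intro n
      rw [List.range_add, List.map_append, List.map_map]
      congr 1
      · apply List.ext_getElem <;> simp +contextual [ρ]
      · exact List.map_congr_left fun i _ => hρ i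
    have hinf := hw.infinite_plays ρ fun n => by
      refine hs.prefix_closed _ ((hlist (n + 1)).symm ▸ (hπ n).2) _ (by simp) ?_
      rw [show List.range (p.length + (n + 1)) = List.range (n + 1) ++ _ by
        rw [add_comm, List.range_add], List.map_append]
      exact List.prefix_append _ _
    intro hfin
    refine hinf (((Set.finite_lt_nat p.length).union (hfin.image (p.length + ·))).subset ?_)
    intro i hi
    by_cases h : i < p.length
    · exact Or.inl h
    · obtain ⟨j, rfl⟩ := Nat.exists_eq_add_of_le (not_lt.1 h)
      exact Or.inr ⟨j, by simpa [hρ] using hi, rfl⟩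

/-- Otherwise some play of the strategy could stay forever among unforced positions, none of which
is winning. -/
theorem DuplicatorWins.forced (hwin : ∀ v ∈ G.win, G.owner v = .spoiler) {v : V}
    (h : G.DuplicatorWins v) : G.Forced v := by
  obtain ⟨s, hs, hw⟩ := h
  by_contra hn
  have key : ∀ (p : List V) (w : V), p ++ [w] ∈ s → ¬ G.Forced w →
      w ∉ G.win ∧ ∃ m, p ++ [w, m] ∈ s ∧ ¬ G.Forced m := by
    intro p w hp hf
    constructor
    · intro hww
      refine hf (.base ⟨hww, fun m hm => ?_⟩)
      have := hs.spoiler_moves p w hp (hwin w hww) m hm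
      exact DuplicatorWins.of_mem hs hw (p := p ++ [w]) (by simpa using this)
    · cases ho : G.owner w with
      | spoiler =>
        by_contra! hall
        exact hf (.spoiler ho fun m hm => hall m (hs.spoiler_moves p w hp ho m hm))
      | duplicator =>
        obtain ⟨m, ⟨hm, hms⟩, -⟩ := hs.duplicator_moves p w hp ho
        exact ⟨m, hms, fun h => hf (.duplicator ho hm h)⟩
  -- The history is part of the state because strategies need not be positional.
  let σ := {x : List V × V // x.1 ++ [x.2] ∈ s ∧ ¬ G.Forced x.2}
  have hnext : ∀ x : σ, ∃ y : σ, y.1.1 = x.1.1 ++ [x.1.2] := by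
    rintro ⟨⟨p, w⟩, hp, hf⟩
    obtain ⟨m, hm, hfm⟩ := (key p w hp hf).2
    exact ⟨⟨(p ++ [w], m), by simpa using hm, hfm⟩, rfl⟩
  choose next hnext using hnext
  let x : ℕ → σ := fun n => next^[n] ⟨([], v), by simpa using hs.singleton_mem, hn⟩
  have hx : ∀ n, (List.range n).map (fun i => (x i).1.2) = (x n).1.1 := by
    intro n
    induction n with
    | zero => rfl
    | succ n ih =>
      rw [List.range_succ, List.map_append, ih]
      simp only [x, Function.iterate_succ_apply', hnext, List.map_cons, List.map_nil]
  refine hw.infinite_plays (fun i => (x i).1.2) (fun n => ?_) ?_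
  · rw [List.range_succ, List.map_append, hx]
    exact (x n).2.1
  · convert Set.finite_empty
    ext i
    simpa using (key _ _ (x i).2.1 (x i).2.2).1

theorem Forced.move (hwin : ∀ v ∈ G.win, G.owner v = .spoiler) {v m : V} (h : G.Forced v)
    (hv : v ∈ G.win) (hm : G.Move v m) : G.Forced m := by
  cases h with
  | base h => exact (h.2 m hm).forced hwin
  | spoiler _ h => exact h m hm
  | duplicator ho => simp [hwin v hv] at ho

end BuchiArena

-- Derived rules of the theory

infix:50 " ≼ " => PointedDerivable

namespace PointedDerivable

variable {α : Type*} {a b c d : RegE α}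

theorem refl (a : RegE α) : a ≼ a := trans (le_comp_one a) (comp_one_le a)

theorem comp_mono_left (h : a ≼ b) : a.comp c ≼ b.comp c := comp_mono h (refl c)

theorem comp_mono_right (h : a ≼ b) : RegE.comp c a ≼ c.comp b := comp_mono (refl c) h

/-- Half-distributivity, for a lower bound of the composition. -/
theorem le_meet_comp (h : a ≼ b.comp c) : a ≼ (a.meet b).comp c :=
  ((le_meet h (refl a)).trans (half_distrib b c a)).trans
    (comp_mono_left (le_meet (meet_le_right _ _) (meet_le_left _ _)))

theorem le_of_le_join (h : a ≼ c.join d) (hc : a.meet c ≼ b) (hd : a.meet d ≼ b) : a ≼ b :=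
  ((le_meet (refl a) h).trans (meet_join a c d)).trans (join_le hc hd)

/-- Induction on the iteration that ends a composition which bounds `a`. -/
theorem le_of_le_comp_iter {k : RegE α} (h : a ≼ k.comp c.iter) (hk : a.meet k ≼ b)
    (hc : a.meet (b.comp c) ≼ b) : a ≼ b :=
  (le_meet (refl a) ((le_meet_comp h).trans (comp_mono_left hk))).trans (iter_induction hc)

end PointedDerivable

/-! ### Finite meets, contexts and transitions -/

namespace RegE

open PointedDerivable

variable {α : Type*}

/-- The meet of `a` and of the elements of `S`. -/
noncomputable def bigMeet (a : RegE α) (S : Finset (RegE α)) : RegE α :=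
  S.toList.foldr meet a

theorem bigMeet_le_base (a : RegE α) (S : Finset (RegE α)) : bigMeet a S ≼ a := by
  unfold bigMeet
  induction S.toList with
  | nil => exact PointedDerivable.refl a
  | cons x l ih => exact (meet_le_right _ _).trans ih

theorem bigMeet_le (a : RegE α) {S : Finset (RegE α)} {x : RegE α} (hx : x ∈ S) :
    bigMeet a S ≼ x := by
  rw [← Finset.mem_toList] at hx
  unfold bigMeet
  revert hx
  induction S.toList with
  | nil => simp
  | cons y l ih =>
    intro hx
    rcases List.mem_cons.1 hx with rfl | hx
    · exact meet_le_left _ _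
    · exact (meet_le_right _ _).trans (ih hx)

theorem le_bigMeet {a z : RegE α} {S : Finset (RegE α)} (ha : z ≼ a) (h : ∀ x ∈ S, z ≼ x) :
    z ≼ bigMeet a S := by
  unfold bigMeet
  simp only [← Finset.mem_toList] at h
  revert h
  induction S.toList with
  | nil => exact fun _ => ha
  | cons y l ih =>
    intro h
    exact le_meet (h y (by simp)) (ih fun x hx => h x (by simp [hx]))

/-- `plug [g₁, …, gₙ] d` is `g₁ ⋆ (… ⋆ (gₙ ⋆ d))`. -/
def plug : List (RegE α) → RegE α → RegE α
  | [], d => d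
  | g :: K, d => comp g (plug K d)

theorem plug_append (K K' : List (RegE α)) (d : RegE α) :
    plug (K ++ K') d = plug K (plug K' d) := by
  induction K with
  | nil => rfl
  | cons g K ih => simp [plug, ih]

theorem plug_mono (K : List (RegE α)) {d d' : RegE α} (h : d ≼ d') : plug K d ≼ plug K d' := by
  induction K with
  | nil => exact h
  | cons g K ih => exact comp_mono_right ih

theorem plug_le_comp (K : List (RegE α)) (d : RegE α) : plug K d ≼ (plug K one).comp d := by
  induction K with
  | nil => exact le_one_comp d
  | cons g K ih => exact (comp_mono_right ih).trans (comp_assoc_le _ _ _)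

theorem comp_le_plug (K : List (RegE α)) (d : RegE α) : (plug K one).comp d ≼ plug K d := by
  induction K with
  | nil => exact one_comp_le d
  | cons g K ih => exact (le_comp_assoc _ _ _).trans (comp_mono_right ih)

theorem pol_plug (K : List (RegE α)) (d : RegE α) : (plug K d).pol = d.pol := by
  induction K with
  | nil => rfl
  | cons g K ih => exact ih

theorem plug_eq_one {K : List (RegE α)} {d : RegE α} (h : plug K d = one) : d = one := by
  cases K with
  | nil => exact h
  | cons g K => simp [plug] at h

theorem Step.plug {d d' : RegE α} (h : d.Step d') (K : List (RegE α)) :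
    (plug K d).Step (plug K d') := by
  induction K with
  | nil => exact h
  | cons g K ih => exact .comp_right _ _ _ ih

/-- The case `d = one` is special because `g ⋆ 1 → g` consumes the context itself. -/
theorem step_plug_iff {K : List (RegE α)} {d t : RegE α} (hd : d ≠ one) :
    (RegE.plug K d).Step t ↔ ∃ d', d.Step d' ∧ t = RegE.plug K d' := by
  refine ⟨fun h => ?_, fun ⟨d', h, ht⟩ => ht ▸ h.plug K⟩
  induction K generalizing t with
  | nil => exact ⟨t, h, rfl⟩
  | cons g K ih =>
    rw [RegE.plug] at h
    generalize hx : RegE.plug K d = x at h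
    cases h with
    | comp_one => exact absurd (plug_eq_one hx) hd
    | comp_right _ _ y hy =>
      subst hx
      obtain ⟨d', h, rfl⟩ := ih hy
      exact ⟨d', h, rfl⟩

/-- This justifies `choose` and `junk`; for a letter it is the axiom `1 ≤ a`. -/
theorem Step.le_of_pol_ne_all {d d' : RegE α} (h : d.Step d') (hd : d.pol ≠ .all) : d' ≼ d := by
  induction h with
  | join_left e f => exact le_join_left _ _
  | join_right e f => exact le_join_right _ _
  | meet_left e f => exact absurd rfl hd
  | meet_right e f => exact absurd rfl hd
  | letter a => exact one_le _
  | comp_one e => exact le_comp_one e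
  | iter_one e => exact one_le_iter e
  | iter_unfold e => exact iter_comp_le e
  | comp_right g e f _ ih => exact comp_mono_right (ih hd)

theorem Step.le_of_pol_eq_all {d d' : RegE α} (h : d.Step d') (hd : d.pol = .all) : d ≼ d' := by
  induction h with
  | meet_left e f => exact meet_le_left _ _
  | meet_right e f => exact meet_le_right _ _
  | comp_right g e f _ ih => exact comp_mono_right (ih hd)
  | _ => simp [pol] at hd

theorem Step.le_comp_letter {d d' : RegE α} {a : α} (h : d.Step d') (hd : d.pol = .call a) :
    d ≼ d'.comp (RegE.letter a) := by
  induction h with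
  | letter b =>
    obtain rfl : b = a := by simpa [pol] using hd
    exact le_one_comp _
  | comp_right g e f _ ih => exact (comp_mono_right (ih hd)).trans (comp_assoc_le _ _ _)
  | _ => simp [pol] at hd

theorem Step.comp_letter_le {d d' : RegE α} {a : α} (h : d.Step d') (hd : d.pol = .call a) :
    d'.comp (RegE.letter a) ≼ d := by
  induction h with
  | letter b =>
    obtain rfl : b = a := by simpa [pol] using hd
    exact one_comp_le _
  | comp_right g e f _ ih => exact (le_comp_assoc _ _ _).trans (comp_mono_right (ih hd))
  | _ => simp [pol] at hd

/-! ### Shapes of transitions and the finite closure -/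

/-- A size that every transition decreases, except for the unfolding of an iteration. -/
def size : RegE α → ℕ
  | letter _ => 2
  | zero => 1
  | join e f => e.size + f.size + 1
  | top => 1
  | meet e f => e.size + f.size + 1
  | one => 1
  | comp e f => e.size + f.size + 1
  | iter e => e.size + 2

theorem size_plug_le {d d' : RegE α} (K : List (RegE α)) (h : d.size < d'.size) :
    (plug K d).size < (plug K d').size := by
  induction K with
  | nil => exact h
  | cons g K ih => simp only [plug, size]; omega

theorem size_le_plug (K : List (RegE α)) (d : RegE α) : d.size ≤ (plug K d).size := by
  induction K with
  | nil => exact le_rfl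
  | cons g K ih => simp only [plug, size]; omega

theorem Step.size_lt_of_call {d d' : RegE α} {a : α} (h : d.Step d') (hd : d.pol = .call a) :
    d'.size < d.size := by
  induction h with
  | letter b => simp [size]
  | comp_right g e f _ ih => have := ih hd; simp only [size]; omega
  | _ => simp [pol] at hd

/-- The transitions of an expression without `0` and `⊤`. -/
inductive Head : RegE α → Prop where
  | one : Head one
  | call (d : RegE α) (a : α) (h : d.pol = .call a) : Head d
  | loop (K : List (RegE α)) (c : RegE α) : Head (plug K (iter c))
  | ex (d d₁ d₂ : RegE α) (h : d.pol = .ex) (h₀ : d ≠ .one) (h₁ : d.Step d₁) (h₂ : d.Step d₂)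
      (hle : d ≼ d₁.join d₂) (hs₁ : d₁.size < d.size) (hs₂ : d₂.size < d.size) : Head d
  | all (d d₁ d₂ : RegE α) (h : d.pol = .all) (hs : ∀ x, d.Step x ↔ x = d₁ ∨ x = d₂)
      (hle : d₁.meet d₂ ≼ d) (hs₁ : d₁.size < d.size) (hs₂ : d₂.size < d.size) : Head d

theorem NoZeroTop.head {d : RegE α} (h : d.NoZeroTop) : Head d := by
  induction d with
  | letter a => exact .call _ a rfl
  | zero => exact h.elim
  | top => exact h.elim
  | one => exact .one
  | iter c => exact .loop [] c
  | join e f =>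
    exact .ex _ e f rfl (by simp) (.join_left e f) (.join_right e f) (PointedDerivable.refl _)
      (by simp only [size]; omega) (by simp only [size]; omega)
  | meet e f =>
    refine .all _ e f rfl (fun x => ⟨fun hx => ?_, ?_⟩) (PointedDerivable.refl _)
      (by simp only [size]; omega) (by simp only [size]; omega)
    · cases hx <;> simp
    · rintro (rfl | rfl)
      exacts [.meet_left _ _, .meet_right _ _]
  | comp g d _ ih =>
    cases ih h.2 with
    | one =>
      -- The only transition is to `g`; it is listed twice to fit the binary form.
      exact .ex _ g g rfl (by simp) (.comp_one g) (.comp_one g)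
        ((comp_one_le g).trans (le_join_left g g)) (by simp [size]) (by simp [size])
    | call _ a ha => exact .call _ a ha
    | loop K c => exact .loop (g :: K) c
    | ex _ d₁ d₂ h h₀ h₁ h₂ hle hs₁ hs₂ =>
      exact .ex _ (g.comp d₁) (g.comp d₂) h (by simp) (.comp_right _ _ _ h₁) (.comp_right _ _ _ h₂)
        ((comp_mono_right hle).trans (comp_join _ _ _)) (by simp only [size]; omega)
        (by simp only [size]; omega)
    | all _ d₁ d₂ h hs hle hs₁ hs₂ =>
      refine .all _ (g.comp d₁) (g.comp d₂) h (fun x => ?_)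
        ((meet_comp _ _ _).trans (comp_mono_right hle)) (by simp only [size]; omega)
        (by simp only [size]; omega)
      have hd : d ≠ .one := by rintro rfl; simp [pol] at h
      rw [show g.comp d = plug [g] d from rfl, step_plug_iff hd]
      simp only [hs, plug]
      grind

/-- A finite set of expressions that contains `e` and is closed under transitions and under
taking the body of an iteration about to be unfolded. -/
noncomputable def closure : RegE α → Finset (RegE α)
  | letter a => {letter a, one}
  | zero => {zero}
  | join e f => insert (join e f) (closure e ∪ closure f)
  | top => {top}
  | meet e f => insert (meet e f) (closure e ∪ closure f)
  | one => {one}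
  | comp e f => (closure f).image (comp e) ∪ (closure e ∪ closure f)
  | iter e => {iter e, one} ∪ ((closure e).image (comp (iter e)) ∪ closure e)

theorem self_mem_closure (e : RegE α) : e ∈ e.closure := by
  induction e <;> simp_all [closure]

theorem closure_step {e d d' : RegE α} (hd : d ∈ e.closure) (h : d.Step d') : d' ∈ e.closure := by
  induction e generalizing d d' with
  | letter a =>
    simp only [closure, Finset.mem_insert, Finset.mem_singleton] at hd ⊢
    rcases hd with rfl | rfl <;> cases h
    simp
  | zero => simp only [closure, Finset.mem_singleton] at hd; subst hd; cases h
  | top => simp only [closure, Finset.mem_singleton] at hd; subst hd; cases h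
  | one => simp only [closure, Finset.mem_singleton] at hd; subst hd; cases h
  | join e f ihe ihf =>
    simp only [closure, Finset.mem_insert, Finset.mem_union] at hd ⊢
    rcases hd with rfl | hd | hd
    · cases h
      · exact .inr (.inl (self_mem_closure e))
      · exact .inr (.inr (self_mem_closure f))
    · exact .inr (.inl (ihe hd h))
    · exact .inr (.inr (ihf hd h))
  | meet e f ihe ihf =>
    simp only [closure, Finset.mem_insert, Finset.mem_union] at hd ⊢
    rcases hd with rfl | hd | hd
    · cases h
      · exact .inr (.inl (self_mem_closure e))
      · exact .inr (.inr (self_mem_closure f))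
    · exact .inr (.inl (ihe hd h))
    · exact .inr (.inr (ihf hd h))
  | comp e f ihe ihf =>
    simp only [closure, Finset.mem_image, Finset.mem_union] at hd ⊢
    rcases hd with ⟨x, hx, rfl⟩ | hd | hd
    · cases h with
      | comp_one => exact .inr (.inl (self_mem_closure e))
      | comp_right _ _ y hy => exact .inl ⟨y, ihf hx hy, rfl⟩
    · exact .inr (.inl (ihe hd h))
    · exact .inr (.inr (ihf hd h))
  | iter e ihe =>
    simp only [closure, Finset.mem_image, Finset.mem_union, Finset.mem_insert,
      Finset.mem_singleton] at hd ⊢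
    rcases hd with (rfl | rfl) | ⟨x, hx, rfl⟩ | hd
    · cases h with
      | iter_one => simp
      | iter_unfold => exact .inr (.inl ⟨e, self_mem_closure e, rfl⟩)
    · cases h
    · cases h with
      | comp_one => simp
      | comp_right _ _ y hy => exact .inr (.inl ⟨y, ihe hx hy, rfl⟩)
    · exact .inr (.inr (ihe hd h))

theorem closure_loop {e c : RegE α} {K : List (RegE α)} (hd : plug K (iter c) ∈ e.closure) :
    c ∈ e.closure := by
  induction e generalizing K with
  | letter a => cases K <;> simp [closure, plug] at hd
  | zero => cases K <;> simp [closure, plug] at hd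
  | top => cases K <;> simp [closure, plug] at hd
  | one => cases K <;> simp [closure, plug] at hd
  | join e f ihe ihf =>
    simp only [closure, Finset.mem_insert, Finset.mem_union] at hd ⊢
    rcases hd with hd | hd | hd
    · cases K <;> simp [plug] at hd
    · exact .inr (.inl (ihe hd))
    · exact .inr (.inr (ihf hd))
  | meet e f ihe ihf =>
    simp only [closure, Finset.mem_insert, Finset.mem_union] at hd ⊢
    rcases hd with hd | hd | hd
    · cases K <;> simp [plug] at hd
    · exact .inr (.inl (ihe hd))
    · exact .inr (.inr (ihf hd))
  | comp e f ihe ihf =>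
    simp only [closure, Finset.mem_image, Finset.mem_union] at hd ⊢
    rcases hd with ⟨x, hx, hd⟩ | hd | hd
    · cases K with
      | nil => simp [plug] at hd
      | cons g K =>
        obtain ⟨rfl, rfl⟩ : e = g ∧ x = plug K (iter c) := by simpa [plug] using hd
        exact .inr (.inr (ihf hx))
    · exact .inr (.inl (ihe hd))
    · exact .inr (.inr (ihf hd))
  | iter e ihe =>
    simp only [closure, Finset.mem_image, Finset.mem_union, Finset.mem_insert,
      Finset.mem_singleton] at hd ⊢
    rcases hd with (hd | hd) | ⟨x, hx, hd⟩ | hd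
    · cases K with
      | nil =>
        obtain rfl : c = e := by simpa [plug] using hd
        exact .inr (.inr (self_mem_closure c))
      | cons g K => simp [plug] at hd
    · cases K <;> simp [plug] at hd
    · cases K with
      | nil => simp [plug] at hd
      | cons g K =>
        obtain ⟨rfl, rfl⟩ : iter e = g ∧ x = plug K (iter c) := by simpa [plug] using hd
        exact .inr (.inr (ihe hx))
    · exact .inr (.inr (ihe hd))

theorem NoZeroTop.of_mem_closure {e d : RegE α} (he : e.NoZeroTop) (hd : d ∈ e.closure) :
    d.NoZeroTop := by
  induction e generalizing d with
  | zero => exact he.elim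
  | top => exact he.elim
  | letter a =>
    simp only [closure, Finset.mem_insert, Finset.mem_singleton] at hd
    rcases hd with rfl | rfl <;> trivial
  | one => simp only [closure, Finset.mem_singleton] at hd; subst hd; trivial
  | join e f ihe ihf =>
    simp only [closure, Finset.mem_insert, Finset.mem_union] at hd
    rcases hd with rfl | hd | hd
    exacts [he, ihe he.1 hd, ihf he.2 hd]
  | meet e f ihe ihf =>
    simp only [closure, Finset.mem_insert, Finset.mem_union] at hd
    rcases hd with rfl | hd | hd
    exacts [he, ihe he.1 hd, ihf he.2 hd]
  | comp e f ihe ihf =>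
    simp only [closure, Finset.mem_image, Finset.mem_union] at hd
    rcases hd with ⟨x, hx, rfl⟩ | hd | hd
    exacts [⟨he.1, ihf he.2 hx⟩, ihe he.1 hd, ihf he.2 hd]
  | iter e ihe =>
    simp only [closure, Finset.mem_image, Finset.mem_union, Finset.mem_insert,
      Finset.mem_singleton] at hd
    rcases hd with (rfl | rfl) | ⟨x, hx, rfl⟩ | hd
    exacts [he, trivial, ⟨he, ihe he hx⟩, ihe he hd]

end RegE

/-! ### Moves of the game and bounds on the right-hand side -/

open RegE

namespace SimPos

variable {α : Type*}

theorem owner_eq_spoiler_iff (p : SimPos α) : p.owner = .spoiler ↔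
    (∃ t ∈ p.X, t ≠ .one ∧ ∀ a, t.pol ≠ .call a) ∨ (p.e = .one ∧ .one ∈ p.X) ∨
      p.e.pol = .all := by
  rw [← or_assoc]
  unfold owner
  split_ifs with h
  · simp only [true_iff]
    exact .inl h
  · cases hp : p.e.pol <;> simp only [h, false_or, reduceCtorEq]

theorem owner_eq_duplicator_iff (p : SimPos α) : p.owner = .duplicator ↔ ¬ p.owner = .spoiler := by
  cases p.owner <;> simp

/-- The moves of Duplicator from a position whose resources all have a polarity `?a`. -/
theorem Move.of_call {p q : SimPos α} (h : Move p q) (hX : ∀ t ∈ p.X, ∃ a, t.pol = .call a)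
    (he : p.e.pol ≠ .all) :
    (p.e.Step q.e ∧ q.X = p.X) ∨
      ∃ a t t', p.e.Step q.e ∧ p.e.pol = .call a ∧ t ∈ p.X ∧ t.pol = .call a ∧ t.Step t' ∧
        q.X = insert t' (p.X.erase t) := by
  cases h with
  | explore Γ X Y X' t t' e ht hX0 hX' hpol hstep =>
    obtain ⟨a, ha⟩ := hX t (by simp [hX0])
    simp [hpol] at ha
  | fork Γ X Y X' t e ht hX0 hX' hpol =>
    obtain ⟨a, ha⟩ := hX t (by simp [hX0])
    simp [hpol] at ha
  | alea p q h =>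
    cases h with
    | mk Γ X e e' hpol => exact absurd hpol he
  | choose Γ X e e' hpos hpol he' => exact .inl ⟨he', rfl⟩
  | junk Γ X e e' a hpos hpol ha he' => exact .inl ⟨he', rfl⟩
  | fill Γ X Y X' t t' e e' a ht hX0 hX' hpos hpol hpolt he' hstep =>
    refine .inr ⟨a, t, t', he', hpol, by simp [hX0], hpolt, hstep, ?_⟩
    simp [hX0, hX', Finset.erase_insert ht]

end SimPos

namespace RegE

open PointedDerivable SimPos BuchiArena

variable {α : Type*}

theorem owner_of_mem_win : ∀ v ∈ (pointedSimGame α).win, (pointedSimGame α).owner v = .spoiler :=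
  fun _ hv => hv.1

/-- Duplicator can force the play from `C ⊣ h` to reach a winning position from which every move
leads to a position won by Duplicator. -/
def Simulates (C : Finset (RegE α)) (h : RegE α) : Prop :=
  (pointedSimGame α).Forced (C, h)

/-- The resource `t` gives the position to Spoiler and blocks `alea`, so the position is winning and
every move from it is safe. -/
theorem Simulates.explore {C : Finset (RegE α)} {h t t' : RegE α} (hC : Simulates C h)
    (ht : t ∈ C) (hpol : t.pol = .ex) (hstep : t.Step t') :
    Simulates (insert t' (C.erase t)) h := by
  have h1 : t ≠ .one := by rintro rfl; cases hstep
  refine Forced.move owner_of_mem_win hC ⟨?_, ?_⟩ ?_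
  · exact (owner_eq_spoiler_iff _).2 (.inl ⟨t, ht, h1, by simp [hpol]⟩)
  · rintro ⟨q, hq⟩
    generalize hp : (⟨Set.univ, C, h⟩ : SimPos α) = p at hq
    cases hq with
    | mk Γ X e e' _ hX =>
      obtain ⟨-, rfl, -⟩ := by simpa using hp
      exact h1 (hX t ht (.inr hpol))
  · exact .explore _ _ (C.erase t) _ t t' _ (by simp) (Finset.insert_erase ht).symm rfl hpol hstep

theorem Simulates.fork {C : Finset (RegE α)} {h t t₁ t₂ : RegE α} (hC : Simulates C h)
    (ht : t ∈ C) (hpol : t.pol = .all) (hstep : ∀ x, t.Step x ↔ x = t₁ ∨ x = t₂) :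
    Simulates ({t₁, t₂} ∪ C.erase t) h := by
  have h1 : t ≠ .one := by rintro rfl; simp [pol] at hpol
  refine Forced.move owner_of_mem_win hC ⟨?_, ?_⟩ ?_
  · exact (owner_eq_spoiler_iff _).2 (.inl ⟨t, ht, h1, by simp [hpol]⟩)
  · rintro ⟨q, hq⟩
    generalize hp : (⟨Set.univ, C, h⟩ : SimPos α) = p at hq
    cases hq with
    | mk Γ X e e' _ hX =>
      obtain ⟨-, rfl, -⟩ := by simpa using hp
      exact h1 (hX t ht (.inl hpol))
  · refine .fork _ _ (C.erase t) _ t _ (by simp) (Finset.insert_erase ht).symm ?_ hpol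
    ext x
    simp only [Finset.coe_union, Finset.coe_insert, Finset.coe_singleton, Set.mem_union,
      Set.mem_ofPred_eq, hstep, Set.mem_insert_iff, Set.mem_singleton_iff]
    tauto

/-- To bound the right-hand side of a position whose resources all have a polarity `?a`, it
suffices to consider the moves `fill`. -/
theorem Simulates.le_of_fill {C : Finset (RegE α)} {f h l : RegE α} (hf : f.NoZeroTop)
    (hh : h ∈ f.closure) (hC : Simulates C h) (hcall : ∀ t ∈ C, ∃ a, t.pol = .call a)
    (hfill : ∀ a t t', ∀ h ∈ f.closure, t ∈ C → t.pol = .call a → t.Step t' →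
      Simulates (insert t' (C.erase t)) h → l ≼ h.comp (letter a)) : l ≼ h := by
  have h1 : .one ∉ C := fun h => by simpa [pol] using hcall _ h
  have hnot : ¬ ∃ t ∈ C, t ≠ .one ∧ ∀ a, t.pol ≠ .call a := by
    rintro ⟨t, ht, -, ht'⟩
    obtain ⟨a, ha⟩ := hcall t ht
    exact ht' a ha
  have hall : ∀ h ∈ f.closure, h.pol = .all →
      (∀ h', h.Step h' → l ≼ h') → l ≼ h := by
    intro h hh hpol hs
    rcases (hf.of_mem_closure hh).head with _ | ⟨_, a, ha⟩ | ⟨K, c⟩ |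
      ⟨_, _, _, ha⟩ | ⟨_, d₁, d₂, -, hst, hle, -, -⟩
    · simp [pol] at hpol
    · simp [ha] at hpol
    · simp [pol_plug, pol] at hpol
    · simp [ha] at hpol
    · exact (le_meet (hs _ ((hst _).2 (.inl rfl))) (hs _ ((hst _).2 (.inr rfl)))).trans hle
  have halea : ∀ h h' : RegE α, h.pol = .all → h.Step h' →
      Alea ⟨Set.univ, C, h⟩ ⟨Set.univ, C, h'⟩ := by
    refine fun h h' hpol hs => .mk _ _ _ _ hpol (fun t ht hp => ?_) hs
    obtain ⟨a, ha⟩ := hcall t ht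
    simp [ha] at hp
  unfold Simulates Forced at hC
  generalize hv : (C, h) = v at hC
  induction hC generalizing h with
  | base hZ =>
    subst hv
    obtain ⟨⟨ho, hno⟩, -⟩ := hZ
    have hpol : h.pol = .all := by
      rcases (owner_eq_spoiler_iff _).1 ho with ho | ho | ho
      exacts [absurd ho hnot, absurd ho.2 h1, ho]
    exact hall h hh hpol fun h' hs => absurd ⟨_, halea h h' hpol hs⟩ hno
  | spoiler ho hm ih =>
    subst hv
    have hpol : h.pol = .all := by
      rcases (owner_eq_spoiler_iff _).1 ho with ho | ho | ho
      exacts [absurd ho hnot, absurd ho.2 h1, ho]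
    exact hall h hh hpol fun h' hs =>
      ih (C, h') (.alea _ _ (halea h h' hpol hs)) (closure_step hh hs) rfl
  | @duplicator v m ho hm hZ ih =>
    subst hv
    have hpol : h.pol ≠ .all := fun hp =>
      (owner_eq_duplicator_iff _).1 ho ((owner_eq_spoiler_iff _).2 (.inr (.inr hp)))
    rcases Move.of_call hm hcall hpol with ⟨hs, hX⟩ | ⟨a, t, t', hs, hp, ht, htp, hts, hX⟩
    · exact (ih (closure_step hh hs) (Prod.ext hX.symm rfl)).trans (hs.le_of_pol_ne_all hpol)
    · refine (hfill a t t' m.2 (closure_step hh hs) ht htp hts ?_).trans (hs.comp_letter_le hp)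
      unfold Simulates Forced
      convert hZ using 1
      exact Prod.ext hX.symm rfl

/-- Some part of the resources `X` is enough for Duplicator. -/
def WeaklySimulates (X : Finset (RegE α)) (h : RegE α) : Prop :=
  ∃ C ⊆ X, Simulates C h

section Saturation

variable (e f : RegE α) (X A : Finset (RegE α))

open Classical in
/-- The meet of `e`, of `X`, and of all right-hand sides that `X` simulates. -/
noncomputable def invariant : RegE α :=
  bigMeet (bigMeet e X) (f.closure.filter (WeaklySimulates X))

/-- The meet of `e`, of `X`, and of `invariant e f X ⋆ d` for all `d ∈ A`. -/
noncomputable def annotated : RegE α :=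
  bigMeet (bigMeet e X) (A.image (comp (invariant e f X)))

/-- A thread `(K, d)` stands for the resource `plug K d`. Either it comes from `X`, or `d ∈ A`
stands for `invariant e f X ⋆ d`. -/
def IsThread (τ : List (RegE α) × RegE α) : Prop :=
  (τ.1 = [] ∧ τ.2 ∈ X) ∨ (τ.2 ∈ A ∧ bigMeet e X ≼ plug τ.1 one ∧ plug τ.1 τ.2 ∈ e.closure)

/-- The total weight of a set of threads. -/
def weight (Θ : Finset (List (RegE α) × RegE α)) : ℕ := ∑ τ ∈ Θ, 3 ^ τ.2.size

/-- The resources of a set of threads. -/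
noncomputable def resources (Θ : Finset (List (RegE α) × RegE α)) : Finset (RegE α) :=
  Θ.image fun τ => plug τ.1 τ.2

variable {e f X A}

theorem invariant_le_bigMeet : invariant e f X ≼ bigMeet e X := bigMeet_le_base _ _

theorem invariant_le {h : RegE α} (hh : h ∈ f.closure) (hX : WeaklySimulates X h) :
    invariant e f X ≼ h := bigMeet_le _ (by simp [hh, hX])

theorem annotated_le_bigMeet : annotated e f X A ≼ bigMeet e X := bigMeet_le_base _ _

theorem annotated_le {d : RegE α} (hd : d ∈ A) :
    annotated e f X A ≼ (invariant e f X).comp d :=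
  bigMeet_le _ (Finset.mem_image_of_mem _ hd)

theorem meet_le_annotated_insert (d : RegE α) :
    (annotated e f X A).meet ((invariant e f X).comp d) ≼ annotated e f X (insert d A) := by
  refine le_bigMeet ((meet_le_left _ _).trans annotated_le_bigMeet) fun x hx => ?_
  obtain ⟨y, hy, rfl⟩ := Finset.mem_image.1 hx
  rcases Finset.mem_insert.1 hy with rfl | hy
  · exact meet_le_right _ _
  · exact (meet_le_left _ _).trans (annotated_le hy)

theorem le_bigMeet_insert {l d : RegE α} (hl : l ≼ bigMeet e X) (hd : l ≼ d) :
    l ≼ bigMeet e (insert d X) := by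
  refine le_bigMeet (hl.trans (bigMeet_le_base _ _)) fun x hx => ?_
  rcases Finset.mem_insert.1 hx with rfl | hx
  · exact hd
  · exact hl.trans (bigMeet_le _ hx)

/-- Replacing the threads with the same resource as `τ` by lighter ones. -/
theorem exists_replace {Θ N : Finset (List (RegE α) × RegE α)} {τ : List (RegE α) × RegE α}
    (hτ : τ ∈ Θ) (hN : weight N < 3 ^ τ.2.size) :
    ∃ Θ', weight Θ' < weight Θ ∧ (∀ x ∈ Θ', x ∈ N ∨ x ∈ Θ) ∧
      resources Θ' = resources N ∪ (resources Θ).erase (plug τ.1 τ.2) := by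
  classical
  refine ⟨N ∪ Θ.filter (fun x => plug x.1 x.2 ≠ plug τ.1 τ.2), ?_, ?_, ?_⟩
  · have h1 : weight (N ∪ Θ.filter (fun x => plug x.1 x.2 ≠ plug τ.1 τ.2)) ≤
        weight N + weight (Θ.filter (fun x => plug x.1 x.2 ≠ plug τ.1 τ.2)) :=
      Finset.sum_union_inter (s₁ := N) (f := fun x => 3 ^ x.2.size) ▸ Nat.le_add_right _ _
    have h2 : weight (Θ.filter (fun x => plug x.1 x.2 ≠ plug τ.1 τ.2)) ≤ weight (Θ.erase τ) := by
      refine Finset.sum_le_sum_of_subset fun x hx => ?_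
      simp only [Finset.mem_filter, Finset.mem_erase] at hx ⊢
      exact ⟨fun h => hx.2 (h ▸ rfl), hx.1⟩
    have h3 : 3 ^ τ.2.size + weight (Θ.erase τ) = weight Θ :=
      Finset.add_sum_erase Θ (fun x => 3 ^ x.2.size) hτ
    omega
  · intro x hx
    simp only [Finset.mem_union, Finset.mem_filter] at hx
    tauto
  · ext x
    simp only [resources, Finset.mem_image, Finset.mem_union, Finset.mem_filter, Finset.mem_erase]
    constructor
    · rintro ⟨y, hy | hy, rfl⟩
      exacts [.inl ⟨y, hy, rfl⟩, .inr ⟨hy.2, y, hy.1, rfl⟩]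
    · rintro (⟨y, hy, rfl⟩ | ⟨hx, y, hy, rfl⟩)
      exacts [⟨y, .inl hy, rfl⟩, ⟨y, .inr ⟨hy, hx⟩, rfl⟩]

theorem weight_singleton_lt {K K' : List (RegE α)} {d d' : RegE α} (h : d'.size < d.size) :
    weight {(K', d')} < 3 ^ ((K, d) : List (RegE α) × RegE α).2.size := by
  simpa [weight] using Nat.pow_lt_pow_right (by norm_num) h

theorem weight_pair_lt {K : List (RegE α)} {d d₁ d₂ : RegE α} (h₁ : d₁.size < d.size)
    (h₂ : d₂.size < d.size) :
    weight {(K, d₁), (K, d₂)} < 3 ^ ((K, d) : List (RegE α) × RegE α).2.size := by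
  have h3 : 3 ^ (d.size - 1) * 3 = 3 ^ d.size := by
    rw [← pow_succ]
    congr 1
    omega
  have p₁ : 3 ^ d₁.size ≤ 3 ^ (d.size - 1) := Nat.pow_le_pow_right (by norm_num) (by omega)
  have p₂ : 3 ^ d₂.size ≤ 3 ^ (d.size - 1) := Nat.pow_le_pow_right (by norm_num) (by omega)
  have hpos : 0 < 3 ^ (d.size - 1) := by positivity
  have : weight {(K, d₁), (K, d₂)} ≤ 3 ^ d₁.size + 3 ^ d₂.size := by
    unfold weight
    by_cases hd : ((K, d₁) : List (RegE α) × RegE α) = (K, d₂)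
    · rw [hd, Finset.pair_eq_singleton]
      simp
    · rw [Finset.sum_pair hd]
  simp only
  omega

theorem resources_singleton (K : List (RegE α)) (d : RegE α) :
    resources {(K, d)} = {plug K d} := by simp [resources]

theorem resources_pair (K : List (RegE α)) (d₁ d₂ : RegE α) :
    resources {(K, d₁), (K, d₂)} = {plug K d₁, plug K d₂} := by simp [resources, Finset.image_insert]

theorem comp_le_plug_of_le {K : List (RegE α)} {d : RegE α} (h : bigMeet e X ≼ plug K one) :
    (invariant e f X).comp d ≼ plug K d :=
  (comp_mono_left (invariant_le_bigMeet.trans h)).trans (comp_le_plug K d)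

theorem IsThread.annotated_le_plug {K : List (RegE α)} {d : RegE α} (h : IsThread e X A (K, d)) :
    annotated e f X A ≼ plug K d := by
  rcases h with ⟨hK, hd⟩ | ⟨hd, hK, -⟩
  · obtain rfl : K = [] := hK
    exact annotated_le_bigMeet.trans (bigMeet_le _ hd)
  · exact (annotated_le hd).trans (comp_le_plug_of_le hK)

end Saturation

section Saturation

variable {e f : RegE α} {X A : Finset (RegE α)}

theorem le_invariant {l : RegE α} (hl : l ≼ bigMeet e X)
    (h : ∀ h ∈ f.closure, ∀ C ⊆ X, Simulates C h → l ≼ h) : l ≼ invariant e f X := by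
  refine le_bigMeet hl fun x hx => ?_
  simp only [Finset.mem_filter] at hx
  obtain ⟨hx, C, hC, hsim⟩ := hx
  exact h x hx C hC hsim

theorem IsThread.mem_closure (hXe : X ⊆ e.closure) {K : List (RegE α)} {d : RegE α}
    (h : IsThread e X A (K, d)) : plug K d ∈ e.closure := by
  rcases h with ⟨hK, hd⟩ | ⟨-, -, h⟩
  · obtain rfl : K = [] := hK
    exact hXe hd
  · exact h

theorem IsThread.snd_mem_closure (hXe : X ⊆ e.closure) (hAe : A ⊆ e.closure)
    {K : List (RegE α)} {d : RegE α} (h : IsThread e X A (K, d)) : d ∈ e.closure := by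
  rcases h with ⟨-, hd⟩ | ⟨hd, -, -⟩
  exacts [hXe hd, hAe hd]

/-- A transition of a thread leads either to a thread, or to a resource that is covered by the
induction hypotheses. -/
theorem IsThread.step (hXe : X ⊆ e.closure) (hAe : A ⊆ e.closure)
    (ihX : ∀ X', X ⊂ X' → X' ⊆ e.closure → ∀ h ∈ f.closure, WeaklySimulates X' h →
      bigMeet e X' ≼ h)
    (ihA : ∀ A', A ⊂ A' → A' ⊆ e.closure → annotated e f X A' ≼ invariant e f X)
    {K : List (RegE α)} {d : RegE α} (hτ : IsThread e X A (K, d)) :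
    ∃ b : RegE α, annotated e f X A ≼ b.comp d ∧ ∀ d', d.Step d' → IsThread e X A (K, d') ∨
      ∀ h ∈ f.closure, ∀ C ⊆ insert (plug K d') X, Simulates C h →
        (annotated e f X A).meet (b.comp d') ≼ h := by
  have hmem := fun d' (hs : d.Step d') => closure_step (hτ.mem_closure hXe) (hs.plug K)
  have hX' : ∀ d' l, d.Step d' → plug K d' ∉ X → l ≼ bigMeet e X → l ≼ plug K d' →
      ∀ h ∈ f.closure, ∀ C ⊆ insert (plug K d') X, Simulates C h → l ≼ h := by
    intro d' l hs hd' hlX hl h hh C hC hsim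
    exact (le_bigMeet_insert hlX hl).trans (ihX _ (Finset.ssubset_insert hd')
      (Finset.insert_subset (hmem d' hs) hXe) h hh ⟨C, hC, hsim⟩)
  rcases hτ with ⟨hK, hd⟩ | ⟨hd, hK, hKd⟩
  · obtain rfl : K = [] := hK
    refine ⟨one, (annotated_le_bigMeet.trans (bigMeet_le _ hd)).trans (le_one_comp _), ?_⟩
    intro d' hs
    by_cases hd' : d' ∈ X
    · exact .inl (.inl ⟨rfl, hd'⟩)
    · exact .inr (hX' d' _ hs hd' ((meet_le_left _ _).trans annotated_le_bigMeet)
        ((meet_le_right _ _).trans (one_comp_le _)))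
  · refine ⟨invariant e f X, annotated_le hd, fun d' hs => ?_⟩
    by_cases hd' : d' ∈ A
    · exact .inl (.inr ⟨hd', hK, hmem d' hs⟩)
    · refine .inr ?_
      by_cases hX : plug K d' ∈ X
      · intro h hh C hC hsim
        rw [Finset.insert_eq_of_mem hX] at hC
        exact ((meet_le_annotated_insert d').trans (ihA _ (Finset.ssubset_insert hd')
          (Finset.insert_subset (closure_step (hAe hd) hs) hAe))).trans
            (invariant_le hh ⟨C, hC, hsim⟩)
      · exact hX' d' _ hs hX ((meet_le_left _ _).trans annotated_le_bigMeet)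
          ((meet_le_right _ _).trans (comp_le_plug_of_le hK))

theorem annotated_le_of_simulates (he : e.NoZeroTop) (hf : f.NoZeroTop)
    (hXe : X ⊆ e.closure) (hAe : A ⊆ e.closure)
    (ihX : ∀ X', X ⊂ X' → X' ⊆ e.closure → ∀ h ∈ f.closure, WeaklySimulates X' h →
      bigMeet e X' ≼ h)
    (ihA : ∀ A', A ⊂ A' → A' ⊆ e.closure → annotated e f X A' ≼ invariant e f X)
    (Θ : Finset (List (RegE α) × RegE α)) (hΘ : ∀ τ ∈ Θ, IsThread e X A τ) {h : RegE α}
    (hh : h ∈ f.closure) (hsim : Simulates (resources Θ) h) : annotated e f X A ≼ h := by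
  induction hn : weight Θ using Nat.strong_induction_on generalizing Θ h with
  | h n ih =>
  subst hn
  by_cases hCX : resources Θ ⊆ X
  swap
  · have hss : X ⊂ X ∪ resources Θ :=
      Finset.ssubset_iff_subset_ne.2 ⟨Finset.subset_union_left, fun h =>
        hCX (Finset.union_eq_left.1 h.symm)⟩
    have hmem : ∀ x ∈ resources Θ, x ∈ e.closure ∧ annotated e f X A ≼ x := by
      intro x hx
      obtain ⟨⟨K, d⟩, hτ, rfl⟩ := Finset.mem_image.1 hx
      exact ⟨(hΘ _ hτ).mem_closure hXe, (hΘ _ hτ).annotated_le_plug⟩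
    refine (le_bigMeet (annotated_le_bigMeet.trans (bigMeet_le_base _ _)) fun x hx => ?_).trans
      (ihX _ hss (Finset.union_subset hXe fun x hx => (hmem x hx).1) h hh
        ⟨_, Finset.subset_union_right, hsim⟩)
    rcases Finset.mem_union.1 hx with hx | hx
    · exact annotated_le_bigMeet.trans (bigMeet_le _ hx)
    · exact (hmem x hx).2
  have hinv : annotated e f X A ≼ invariant e f X → annotated e f X A ≼ h :=
    fun hi => hi.trans (invariant_le hh ⟨_, hCX, hsim⟩)
  have hrepl : ∀ {K d} {N : Finset (List (RegE α) × RegE α)} {h}, (K, d) ∈ Θ →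
      weight N < 3 ^ ((K, d) : List (RegE α) × RegE α).2.size → (∀ τ ∈ N, IsThread e X A τ) →
      h ∈ f.closure → Simulates (resources N ∪ (resources Θ).erase (plug K d)) h →
      annotated e f X A ≼ h := by
    intro K d N h hτ hN hNt hh hs
    obtain ⟨Θ', hw, hsub, hres⟩ := exists_replace hτ hN
    exact ih _ hw Θ' (fun τ hτ => (hsub τ hτ).elim (hNt τ) (hΘ τ)) hh (hres ▸ hs) rfl
  have hrepl₁ : ∀ {K d K' d' h}, (K, d) ∈ Θ → d'.size < d.size → IsThread e X A (K', d') →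
      h ∈ f.closure → Simulates (insert (plug K' d') ((resources Θ).erase (plug K d))) h →
      annotated e f X A ≼ h := by
    intro K d K' d' h hτ hd ht hh hs
    refine hrepl hτ (weight_singleton_lt (K' := K') hd) (by simpa using ht) hh ?_
    rwa [resources_singleton]
  by_cases hcall : ∀ t ∈ resources Θ, ∃ a, t.pol = .call a
  · refine hsim.le_of_fill hf hh hcall fun a t t' h' hh' ht hpol hst hs => ?_
    obtain ⟨⟨K, d⟩, hτ, rfl⟩ := Finset.mem_image.1 ht
    simp only [pol_plug] at hpol hst hs
    obtain ⟨d', hd', rfl⟩ := (step_plug_iff (by rintro rfl; simp [pol] at hpol)).1 hst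
    obtain ⟨b, hb, hstep⟩ := (hΘ _ hτ).step hXe hAe ihX ihA
    rcases hstep d' hd' with hok | hle
    · exact (hrepl₁ hτ (hd'.size_lt_of_call hpol) hok hh' hs).trans
        ((le_comp_one _).trans (comp_mono_right (one_le _)))
    · refine (le_meet_comp ((hb.trans (comp_mono_right (hd'.le_comp_letter hpol))).trans
        (comp_assoc_le _ _ _))).trans (comp_mono_left (hle h' hh' _ ?_ hs))
      exact Finset.insert_subset_insert _ ((Finset.erase_subset _ _).trans hCX)
  · push Not at hcall
    obtain ⟨t, ht, hpol⟩ := hcall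
    obtain ⟨⟨K, d⟩, hτ, rfl⟩ := Finset.mem_image.1 ht
    simp only [pol_plug] at hpol ht
    have hd := (hΘ _ hτ).snd_mem_closure hXe hAe
    obtain ⟨b, hb, hstep⟩ := (hΘ _ hτ).step hXe hAe ihX ihA
    have hCX' : ∀ x, resources Θ ⊆ insert x X := fun x => hCX.trans (Finset.subset_insert x X)
    rcases (he.of_mem_closure hd).head with _ | ⟨_, a, ha⟩ | ⟨D, c⟩ |
      ⟨_, d₁, d₂, hp, -, h₁, h₂, hle, hs₁, hs₂⟩ | ⟨_, d₁, d₂, hp, hst, -, hs₁, hs₂⟩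
    · rcases hΘ _ hτ with ⟨-, h1⟩ | ⟨h1, -⟩
      · exact (annotated_le_bigMeet.trans (bigMeet_le _ h1)).trans (one_le _)
      · exact hinv ((annotated_le h1).trans (comp_one_le _))
    · exact absurd ha (hpol a)
    · have hp : (plug K (plug D (iter c))).pol = .ex := by simp [pol_plug, pol]
      have hexit : (plug D (iter c)).Step (plug D one) := (Step.iter_one c).plug D
      have hunfold : (plug D (iter c)).Step (plug D ((iter c).comp c)) :=
        (Step.iter_unfold c).plug D
      have hsize : (one : RegE α).size < (iter c).size := by simp only [size]; omega
      rcases hstep _ hexit with hok | hle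
      · exact hrepl₁ hτ (size_plug_le D hsize) hok hh (hsim.explore ht hp (hexit.plug K))
      by_cases hc : c ∈ A
      · have hcsize : c.size < (plug D (iter c)).size :=
          lt_of_lt_of_le (by simp [size]) (size_le_plug D (iter c))
        have heq : ∀ x, plug (K ++ D ++ [iter c]) x = plug K (plug D ((iter c).comp x)) := by
          intro x
          simp [plug_append, plug]
        refine hrepl₁ (K' := K ++ D ++ [iter c]) hτ hcsize (.inr ⟨hc, ?_, ?_⟩) hh ?_
        · simp only [heq]
          exact (bigMeet_le _ (hCX ht)).trans (plug_mono K (plug_mono D (le_comp_one _)))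
        · simp only [heq]
          exact closure_step ((hΘ _ hτ).mem_closure hXe) (hunfold.plug K)
        · rw [heq]
          exact hsim.explore ht hp (hunfold.plug K)
      · refine hinv (le_of_le_comp_iter (k := b.comp (plug D one)) (c := c) ?_ ?_ ?_)
        · exact (hb.trans (comp_mono_right (plug_le_comp D _))).trans (comp_assoc_le _ _ _)
        · exact le_invariant ((meet_le_left _ _).trans annotated_le_bigMeet)
            fun h hh C hC => hle h hh C (hC.trans (Finset.subset_insert _ _))
        · exact (meet_le_annotated_insert c).trans (ihA _ (Finset.ssubset_insert hc)
            (Finset.insert_subset (closure_loop hd) hAe))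
    · have hp' : (plug K d).pol = .ex := by rw [pol_plug, hp]
      rcases hstep _ h₁ with hok₁ | hle₁
      · exact hrepl₁ hτ hs₁ hok₁ hh (hsim.explore ht hp' (h₁.plug K))
      rcases hstep _ h₂ with hok₂ | hle₂
      · exact hrepl₁ hτ hs₂ hok₂ hh (hsim.explore ht hp' (h₂.plug K))
      exact le_of_le_join ((hb.trans (comp_mono_right hle)).trans (comp_join _ _ _))
        (hle₁ h hh _ (hCX' _) hsim) (hle₂ h hh _ (hCX' _) hsim)
    · have hp' : (plug K d).pol = .all := by rw [pol_plug, hp]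
      have h₁ : d.Step d₁ := (hst _).2 (.inl rfl)
      have h₂ : d.Step d₂ := (hst _).2 (.inr rfl)
      rcases hstep _ h₁ with hok₁ | hle₁
      · rcases hstep _ h₂ with hok₂ | hle₂
        · refine hrepl hτ (weight_pair_lt hs₁ hs₂) ?_ hh ?_
          · intro τ hτ
            rcases Finset.mem_insert.1 hτ with rfl | hτ
            · exact hok₁
            · rwa [Finset.mem_singleton.1 hτ]
          · rw [resources_pair]
            refine hsim.fork ht hp' fun x => ?_
            rw [step_plug_iff (by rintro rfl; simp [pol] at hp)]
            simp only [hst]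
            grind
        · exact (le_meet (PointedDerivable.refl _) (hb.trans
            (comp_mono_right (h₂.le_of_pol_eq_all hp)))).trans (hle₂ h hh _ (hCX' _) hsim)
      · exact (le_meet (PointedDerivable.refl _) (hb.trans
          (comp_mono_right (h₁.le_of_pol_eq_all hp)))).trans (hle₁ h hh _ (hCX' _) hsim)

/-- Induction from above on the subsets of a finite set. -/
theorem ssuperset_induction {β : Type*} {R : Finset β} {p : Finset β → Prop}
    (ih : ∀ S ⊆ R, (∀ S', S ⊂ S' → S' ⊆ R → p S') → p S) {S : Finset β} (hS : S ⊆ R) : p S := by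
  induction hn : R.card - S.card using Nat.strong_induction_on generalizing S with
  | h n hi =>
    subst hn
    refine ih S hS fun S' hSS' hS' => hi _ ?_ hS' rfl
    have h1 := Finset.card_lt_card hSS'
    have h2 := Finset.card_le_card hS'
    omega

theorem bigMeet_le_of_weaklySimulates (he : e.NoZeroTop) (hf : f.NoZeroTop)
    (hX : X ⊆ e.closure) {h : RegE α} (hh : h ∈ f.closure) (hsim : WeaklySimulates X h) :
    bigMeet e X ≼ h := by
  refine ssuperset_induction (R := e.closure)
    (p := fun X => ∀ h ∈ f.closure, WeaklySimulates X h → bigMeet e X ≼ h)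
    (fun X hXe ihX h hh hsim => ?_) hX h hh hsim
  have key : annotated e f X ∅ ≼ invariant e f X := by
    refine ssuperset_induction (R := e.closure)
      (p := fun A => annotated e f X A ≼ invariant e f X) (fun A hAe ihA => ?_)
      (Finset.empty_subset _)
    refine le_invariant annotated_le_bigMeet fun h hh C hC hsim => ?_
    refine annotated_le_of_simulates he hf hXe hAe ihX ihA
      (C.image fun d => (([], d) : List (RegE α) × RegE α)) ?_ hh ?_
    · intro τ hτ
      obtain ⟨d, hd, rfl⟩ := Finset.mem_image.1 hτ
      exact .inl ⟨rfl, hC hd⟩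
    · convert hsim
      simp [resources, Finset.image_image, Function.comp_def, plug]
  exact (le_bigMeet (PointedDerivable.refl _) (by simp)).trans (key.trans (invariant_le hh hsim))

end Saturation

end RegE

theorem mainTheorem3 {α : Type*} [Finite α] (e f : RegE α)
    (he : e.NoZeroTop) (hf : f.NoZeroTop)
    (hwin : (pointedSimGame α).DuplicatorWins ({e}, f)) :
    PointedDerivable e f := by
  refine (RegE.le_bigMeet (.refl e) ?_).trans (RegE.bigMeet_le_of_weaklySimulates (X := {e}) he hf
    (by simpa using e.self_mem_closure) f.self_mem_closure
    ⟨{e}, subset_rfl, hwin.forced RegE.owner_of_mem_win⟩)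
  simpa using PointedDerivable.refl e
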